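/- A distributive bilattice is an algebra $\mathbf A=(A;\vee_t,\wedge_t,\neg,0_t,1_t,0_k,1_k)$ such that, with $$a\vee_k b=((a\wedge_t b)\wedge_t 0_k)\vee_t((a\vee_t b)\wedge_t 1_k),\qquad a\wedge_k b=((a\wedge_t b)\wedge_t 1_k)\vee_t((a\vee_t b)\wedge_t 0_k),$$ both $(A;\vee_t,\wedge_t,0_t,1_t)$ and $(A;\vee_k,\wedge_k,0_k,1_k)$ are bounded lattices, each of $\vee_t,\wedge_t,\vee_k,\wedge_k$ distributes over each of the other three, and $\neg$ is an involution which is a dual endomorphism of the bounded lattice $\mathbf A_t=(A;\vee_t,\wedge_t,0_t,1_t)$ (the $t$-lattice reduct) and an endomorphism of the bounded lattice $(A;\vee_k,\wedge_k,0_k,1_k)$. Let $\mathbf 4$ be the distributive bilattice on $\{0,1\}^2$ in which $\leq_t$ is the product order, $0_t=00$, $1_t=11$, $0_k=01$, $1_k=10$, and $\neg$ switches $00$ and $11$ and fixes $01$ and $10$; its knowledge order is given by $a_1a_2\leq_k b_1b_2$ if and only if $a_1\leq b_1$ and $b_2\leq a_2$. A Priestley space is a compact, totally order-disconnected partially ordered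 topological space (possibly empty); morphisms of Priestley spaces are the continuous order-preserving maps. Let $\mathcal P$ be the category of Priestley spaces. For a bounded distributive lattice $\mathbf L$, its Priestley dual $\mathsf H(\mathbf L)$ is the set of bounded lattice homomorphisms from $\mathbf L$ to the two-element chain $\mathbf 2$, with the pointwise order and the topology induced from the product topology on $\{0,1\}^L$ ($\{0,1\}$ discrete). For a distributive bilattice $\mathbf A$, its natural dual $\mathsf D(\mathbf A)$ is the set of homomorphisms from $\mathbf A$ to $\mathbf 4$, ordered by the pointwise lifting of $\leq_k$ and with the topology induced from the product topology on $(\{0,1\}^2)^A$ ($\{0,1\}^2$ discrete). Both are Priestley spaces. For a Priestley space $X$, let $X^\partial$ be the Priestley space with the same topology and the reversed order. **Theorem.** For every distributive bilattice $\mathbf A$ there is an isomorphism of Priestley spaces $$\mathsf H(\mathbf A_t)\;\cong\;\mathsf D(\mathbf A)\,\textstyle\coprod_{\mathcal P}\,\mathsf D(\mathbf A)^\partial,$$ where $\coprod_{\mathcal P}$ is the coproduct in $\mathcal P$. Equivalently, $\mathsf H(\mathbf A_t)$ is isomorphic to the disjoint union of $\mathsf D(\mathbf A)$ and $\mathsf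 D(\mathbf A)^\partial$, with the disjoint union topology and with elements of different summands incomparable. -/

import Mathlib

open CategoryTheory CategoryTheory.Limits

universe u v

/-! ### Distributive bilattices -/

/-- Unbounded distributive pre-bilattices.  The truth lattice is the ambient `DistribLattice`
structure, with operations `⊔`, `⊓`; the knowledge lattice has operations `supK`, `infK`.  Each of
the four operations distributes over each of the other three (the two laws involving only `⊔` and
`⊓` are part of `DistribLattice`). -/
class UnboundedDistribPreBilattice (A : Type u) extends DistribLattice A where
  supK : A → A → A
  infK : A → A → A
  supK_comm : ∀ a b, supK a b = supK b a
  infK_comm : ∀ a b, infK a b = infK b a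
  supK_assoc : ∀ a b c, supK (supK a b) c = supK a (supK b c)
  infK_assoc : ∀ a b c, infK (infK a b) c = infK a (infK b c)
  supK_infK_self : ∀ a b, supK a (infK a b) = a
  infK_supK_self : ∀ a b, infK a (supK a b) = a
  supK_infK_distrib : ∀ a b c, supK a (infK b c) = infK (supK a b) (supK a c)
  infK_supK_distrib : ∀ a b c, infK a (supK b c) = supK (infK a b) (infK a c)
  sup_supK_distrib : ∀ a b c : A, a ⊔ supK b c = supK (a ⊔ b) (a ⊔ c)
  sup_infK_distrib : ∀ a b c : A, a ⊔ infK b c = infK (a ⊔ b) (a ⊔ c)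
  inf_supK_distrib : ∀ a b c : A, a ⊓ supK b c = supK (a ⊓ b) (a ⊓ c)
  inf_infK_distrib : ∀ a b c : A, a ⊓ infK b c = infK (a ⊓ b) (a ⊓ c)
  supK_sup_distrib : ∀ a b c : A, supK a (b ⊔ c) = supK a b ⊔ supK a c
  supK_inf_distrib : ∀ a b c : A, supK a (b ⊓ c) = supK a b ⊓ supK a c
  infK_sup_distrib : ∀ a b c : A, infK a (b ⊔ c) = infK a b ⊔ infK a c
  infK_inf_distrib : ∀ a b c : A, infK a (b ⊓ c) = infK a b ⊓ infK a c

/-- Distributive pre-bilattices: the bounds `⊥`, `⊤` of the truth lattice and `botK`, `topK` of the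
knowledge lattice are constants of the language.  The knowledge operations are not basic: they are
given by terms in `⊔`, `⊓`, `botK`, `topK`. -/
class DistribPreBilattice (A : Type u) extends UnboundedDistribPreBilattice A, BoundedOrder A where
  botK : A
  topK : A
  supK_eq : ∀ a b : A, supK a b = ((a ⊓ b) ⊓ botK) ⊔ ((a ⊔ b) ⊓ topK)
  infK_eq : ∀ a b : A, infK a b = ((a ⊓ b) ⊓ topK) ⊔ ((a ⊔ b) ⊓ botK)
  supK_botK : ∀ a : A, supK a botK = a
  infK_topK : ∀ a : A, infK a topK = a

/-- Distributive bilattices: distributive pre-bilattices with an involution `neg` that is a dual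
endomorphism of the bounded truth lattice and an endomorphism of the bounded knowledge lattice. -/
class DistribBilattice (A : Type u) extends DistribPreBilattice A where
  neg : A → A
  neg_neg : ∀ a, neg (neg a) = a
  neg_sup : ∀ a b : A, neg (a ⊔ b) = neg a ⊓ neg b
  neg_inf : ∀ a b : A, neg (a ⊓ b) = neg a ⊔ neg b
  neg_bot : neg (⊥ : A) = ⊤
  neg_top : neg (⊤ : A) = ⊥
  neg_supK : ∀ a b : A, neg (supK a b) = supK (neg a) (neg b)
  neg_infK : ∀ a b : A, neg (infK a b) = infK (neg a) (neg b)
  neg_botK : neg botK = botK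
  neg_topK : neg topK = topK

open UnboundedDistribPreBilattice (supK infK)

open DistribPreBilattice (botK topK)

open DistribBilattice (neg)

/-- The knowledge order `a ≤ₖ b` of a pre-bilattice. -/
def LeK {A : Type u} [UnboundedDistribPreBilattice A] (a b : A) : Prop := infK a b = a

theorem LeK.refl {A : Type u} [UnboundedDistribPreBilattice A] (a : A) : LeK a a := by
  have h := UnboundedDistribPreBilattice.infK_supK_self a (infK a a)
  rwa [UnboundedDistribPreBilattice.supK_infK_self] at h

theorem LeK.trans {A : Type u} [UnboundedDistribPreBilattice A] {a b c : A}
    (hab : LeK a b) (hbc : LeK b c) : LeK a c := by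
  unfold LeK at *
  rw [← hab, UnboundedDistribPreBilattice.infK_assoc, hbc]

theorem LeK.antisymm {A : Type u} [UnboundedDistribPreBilattice A] {a b : A}
    (hab : LeK a b) (hba : LeK b a) : a = b := by
  unfold LeK at *
  rw [← hab, UnboundedDistribPreBilattice.infK_comm, hba]

/-- Homomorphisms of distributive bilattices: maps preserving `⊔`, `⊓`, `neg` and the four
constants. -/
structure BilatticeHom (A : Type u) (B : Type v) [DistribBilattice A] [DistribBilattice B]
    extends BoundedLatticeHom A B where
  map_neg : ∀ a, toFun (neg a) = neg (toFun a)
  map_botK : toFun botK = botK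
  map_topK : toFun topK = topK

instance {A : Type u} {B : Type v} [DistribBilattice A] [DistribBilattice B] :
    FunLike (BilatticeHom A B) A B where
  coe f := f.toFun
  coe_injective f g h := by
    obtain ⟨f, _, _, _⟩ := f
    obtain ⟨g, _, _, _⟩ := g
    obtain rfl : f = g := DFunLike.ext _ _ (fun a => congrFun h a)
    rfl

/-! ### The four-element distributive bilattice -/

/-- The set of binary strings of length two; the truth order is the product order. -/
def Four : Type := Bool × Bool

namespace Four

instance : DecidableEq Four := inferInstanceAs (DecidableEq (Bool × Bool))

instance : Fintype Four := inferInstanceAs (Fintype (Bool × Bool))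

instance : DistribLattice Four := inferInstanceAs (DistribLattice (Bool × Bool))

instance : BoundedOrder Four := inferInstanceAs (BoundedOrder (Bool × Bool))

def kSup (a b : Four) : Four := (a.1 || b.1, a.2 && b.2)

def kInf (a b : Four) : Four := (a.1 && b.1, a.2 || b.2)

def kBot : Four := (false, true)

def kTop : Four := (true, false)

def negation (a : Four) : Four := (!a.2, !a.1)

/-- Here `00 ≤ₜ 01, 10 ≤ₜ 11` and `01 ≤ₖ 00, 11 ≤ₖ 10`; negation switches `00` and `11` and fixes
`01` and `10`. -/
instance : DistribBilattice Four where
  supK := kSup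
  infK := kInf
  botK := kBot
  topK := kTop
  neg := negation
  supK_comm := by decide
  infK_comm := by decide
  supK_assoc := by decide
  infK_assoc := by decide
  supK_infK_self := by decide
  infK_supK_self := by decide
  supK_infK_distrib := by decide
  infK_supK_distrib := by decide
  sup_supK_distrib := by decide
  sup_infK_distrib := by decide
  inf_supK_distrib := by decide
  inf_infK_distrib := by decide
  supK_sup_distrib := by decide
  supK_inf_distrib := by decide
  infK_sup_distrib := by decide
  infK_inf_distrib := by decide
  supK_eq := by decide
  infK_eq := by decide
  supK_botK := by decide
  infK_topK := by decide
  neg_neg := by decide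
  neg_sup := by decide
  neg_inf := by decide
  neg_bot := by decide
  neg_top := by decide
  neg_supK := by decide
  neg_infK := by decide
  neg_botK := by decide
  neg_topK := by decide

instance : TopologicalSpace Four := ⊥

instance : DiscreteTopology Four := ⟨rfl⟩

end Four

/-! ### The category of Priestley spaces -/

instance OrderDual.instPriestleySpace {X : Type u} [TopologicalSpace X] [PartialOrder X]
    [PriestleySpace X] : PriestleySpace Xᵒᵈ where
  priestley {x y} h := by
    obtain ⟨U, hU, hlow, hx, hy⟩ :=
      exists_isClopen_lower_of_not_le (x := OrderDual.ofDual y) (y := OrderDual.ofDual x) h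
    exact ⟨OrderDual.ofDual ⁻¹' U, hU.preimage continuous_id, fun a b hab ha => hlow hab ha,
      hy, hx⟩

/-- The order on a sum is the disjoint one: elements of different summands are incomparable. -/
instance Sum.instPriestleySpace {X : Type u} {Y : Type v} [TopologicalSpace X] [PartialOrder X]
    [PriestleySpace X] [TopologicalSpace Y] [PartialOrder Y] [PriestleySpace Y] :
    PriestleySpace (X ⊕ Y) where
  priestley {x y} h := by
    rcases x with x | x <;> rcases y with y | y
    · obtain ⟨U, hU, hup, hx, hy⟩ :=
        exists_isClopen_upper_of_not_le (fun hxy => h (Sum.inl_le_inl_iff.2 hxy))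
      refine ⟨Sum.inl '' U, ⟨Topology.IsClosedEmbedding.inl.isClosedMap _ hU.1,
        isOpenMap_inl _ hU.2⟩, ?_, ⟨x, hx, rfl⟩, ?_⟩
      · rintro _ (b | b) hab ⟨a, ha, rfl⟩
        · exact ⟨b, hup (Sum.inl_le_inl_iff.1 hab) ha, rfl⟩
        · exact absurd hab Sum.not_inl_le_inr
      · rintro ⟨a, ha, hay⟩
        exact hy (Sum.inl_injective hay ▸ ha)
    · refine ⟨Set.range Sum.inl, isClopen_range_inl, ?_, ⟨x, rfl⟩, by simp⟩
      rintro _ (b | b) hab ⟨a, rfl⟩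
      · exact ⟨b, rfl⟩
      · exact absurd hab Sum.not_inl_le_inr
    · refine ⟨Set.range Sum.inr, isClopen_range_inr, ?_, ⟨x, rfl⟩, by simp⟩
      rintro _ (b | b) hab ⟨a, rfl⟩
      · exact absurd hab Sum.not_inr_le_inl
      · exact ⟨b, rfl⟩
    · obtain ⟨U, hU, hup, hx, hy⟩ :=
        exists_isClopen_upper_of_not_le (fun hxy => h (Sum.inr_le_inr_iff.2 hxy))
      refine ⟨Sum.inr '' U, ⟨Topology.IsClosedEmbedding.inr.isClosedMap _ hU.1,
        isOpenMap_inr _ hU.2⟩, ?_, ⟨x, hx, rfl⟩, ?_⟩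
      · rintro _ (b | b) hab ⟨a, ha, rfl⟩
        · exact absurd hab Sum.not_inr_le_inl
        · exact ⟨b, hup (Sum.inr_le_inr_iff.1 hab) ha, rfl⟩
      · rintro ⟨a, ha, hay⟩
        exact hy (Sum.inr_injective hay ▸ ha)

/-- Priestley spaces: compact, totally order-disconnected ordered spaces.  The empty space is
allowed. -/
structure Priestley : Type (u + 1) where
  of ::
  carrier : Type u
  [topology : TopologicalSpace carrier]
  [order : PartialOrder carrier]
  [compact : CompactSpace carrier]
  [priestley : PriestleySpace carrier]

namespace Priestley

attribute [instance] topology order compact priestley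

/-- Morphisms are the continuous order-preserving maps. -/
@[ext]
structure Hom (X Y : Priestley.{u}) where
  hom : X.carrier →Co Y.carrier

instance : Category Priestley.{u} where
  Hom X Y := Hom X Y
  id X := ⟨ContinuousOrderHom.id X.carrier⟩
  comp f g := ⟨g.hom.comp f.hom⟩

/-- The Priestley space with the same topology and the reversed order. -/
def orderDual (X : Priestley.{u}) : Priestley.{u} :=
  haveI : CompactSpace (X.carrier)ᵒᵈ := X.compact
  of (X.carrier)ᵒᵈ

/-- The disjoint union of two Priestley spaces, with the disjoint union topology and order. -/
def disjointUnion (X Y : Priestley.{u}) : Priestley.{u} := of (X.carrier ⊕ Y.carrier)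

/-- The inclusion of the first summand. -/
def inl (X Y : Priestley.{u}) : X ⟶ disjointUnion X Y :=
  ⟨⟨⟨Sum.inl, fun _ _ h => Sum.inl_le_inl_iff.2 h⟩, continuous_inl⟩⟩

/-- The inclusion of the second summand. -/
def inr (X Y : Priestley.{u}) : Y ⟶ disjointUnion X Y :=
  ⟨⟨⟨Sum.inr, fun _ _ h => Sum.inr_le_inr_iff.2 h⟩, continuous_inr⟩⟩

/-- The map out of a disjoint union given by two maps. -/
def desc {X Y Z : Priestley.{u}} (f : X ⟶ Z) (g : Y ⟶ Z) : disjointUnion X Y ⟶ Z :=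
  ⟨⟨⟨Sum.elim f.hom g.hom, by
    rintro (a | a) (b | b) h
    · exact f.hom.monotone' (Sum.inl_le_inl_iff.1 h)
    · exact absurd h Sum.not_inl_le_inr
    · exact absurd h Sum.not_inr_le_inl
    · exact g.hom.monotone' (Sum.inr_le_inr_iff.1 h)⟩,
    f.hom.continuous_toFun.sumElim g.hom.continuous_toFun⟩⟩

/-- The disjoint union is the coproduct. -/
def disjointUnionIsColimit (X Y : Priestley.{u}) :
    IsColimit (BinaryCofan.mk (inl X Y) (inr X Y)) :=
  BinaryCofan.isColimitMk (fun s => desc s.inl s.inr)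
    (fun _ => rfl) (fun _ => rfl)
    (fun s m h₁ h₂ => by
      apply Hom.ext
      apply ContinuousOrderHom.ext
      rintro (a | a)
      · exact DFunLike.congr_fun (congrArg Hom.hom h₁) a
      · exact DFunLike.congr_fun (congrArg Hom.hom h₂) a)

/-- Binary coproducts exist, so that `X ⨿ Y` makes sense in the category of Priestley spaces. -/
instance (X Y : Priestley.{u}) : HasBinaryCoproduct X Y :=
  ⟨⟨⟨_, disjointUnionIsColimit X Y⟩⟩⟩

end Priestley

/-! ### The Priestley dual of a bounded distributive lattice -/

/-- Bounded lattice homomorphisms to the two-element chain `false < true`, with the topology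
induced from the product of copies of the discrete space `Bool`, and the pointwise order. -/
def PriestleyDual (L : Type u) [DistribLattice L] [BoundedOrder L] : Type u :=
  BoundedLatticeHom L Bool

namespace PriestleyDual

variable {L : Type u} [DistribLattice L] [BoundedOrder L]

instance : FunLike (PriestleyDual L) L Bool :=
  inferInstanceAs (FunLike (BoundedLatticeHom L Bool) L Bool)

instance : TopologicalSpace (PriestleyDual L) :=
  TopologicalSpace.induced (fun x : PriestleyDual L => (x : L → Bool)) inferInstance

instance : PartialOrder (PriestleyDual L) :=
  PartialOrder.lift (fun x : PriestleyDual L => (x : L → Bool)) DFunLike.coe_injective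

theorem continuous_eval (a : L) : Continuous fun x : PriestleyDual L => x a :=
  (continuous_apply a).comp continuous_induced_dom

instance : CompactSpace (PriestleyDual L) := by
  have hind : Topology.IsInducing (fun x : PriestleyDual L => (x : L → Bool)) := ⟨rfl⟩
  have hrange : Set.range (fun x : PriestleyDual L => (x : L → Bool)) =
      {f | (∀ a b, f (a ⊔ b) = f a ⊔ f b) ∧ (∀ a b, f (a ⊓ b) = f a ⊓ f b) ∧
        f ⊤ = ⊤ ∧ f ⊥ = ⊥} := by
    ext f
    constructor
    · rintro ⟨x, rfl⟩
      exact ⟨fun a b => x.map_sup' a b, fun a b => x.map_inf' a b, x.map_top', x.map_bot'⟩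
    · rintro ⟨h₁, h₂, h₃, h₄⟩
      exact ⟨(⟨⟨⟨f, h₁⟩, h₂⟩, h₃, h₄⟩ : BoundedLatticeHom L Bool), rfl⟩
  have hclosed : IsClosed (Set.range (fun x : PriestleyDual L => (x : L → Bool))) := by
    rw [hrange]
    simp only [Set.ofPred_and, Set.ofPred_forall]
    refine .inter ?_ (.inter ?_ (.inter ?_ ?_))
    · exact isClosed_iInter fun a => isClosed_iInter fun b => isClosed_eq (continuous_apply _)
        ((continuous_of_discreteTopology (f := fun p : Bool × Bool => p.1 ⊔ p.2)).comp₂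
          (continuous_apply a) (continuous_apply b))
    · exact isClosed_iInter fun a => isClosed_iInter fun b => isClosed_eq (continuous_apply _)
        ((continuous_of_discreteTopology (f := fun p : Bool × Bool => p.1 ⊓ p.2)).comp₂
          (continuous_apply a) (continuous_apply b))
    · exact isClosed_eq (continuous_apply _) continuous_const
    · exact isClosed_eq (continuous_apply _) continuous_const
  rw [← isCompact_univ_iff, hind.isCompact_iff, Set.image_univ]
  exact hclosed.isCompact

instance : PriestleySpace (PriestleyDual L) where
  priestley {x y} h := by
    have h' : ¬ ∀ a, x a ≤ y a := h
    push Not at h'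
    obtain ⟨a, ha⟩ := h'
    obtain ⟨hy, hx⟩ := Bool.lt_iff.1 ha
    refine ⟨(fun z : PriestleyDual L => z a) ⁻¹' {true},
      (isClopen_discrete _).preimage (continuous_eval a), ?_, hx, ?_⟩
    · intro z w hzw hz
      have h1 : z a ≤ w a := hzw a
      have h2 : z a = true := hz
      rw [h2] at h1
      exact top_le_iff.1 h1
    · intro hy'
      have h2 : y a = true := hy'
      simp [hy] at h2

end PriestleyDual

/-- The Priestley dual of a bounded distributive lattice, as a Priestley space. -/
def priestleyDual (L : Type u) [DistribLattice L] [BoundedOrder L] : Priestley.{u} :=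
  Priestley.of (PriestleyDual L)

/-! ### The natural dual of a distributive bilattice -/

/-- Homomorphisms to the four-element bilattice, as a substructure of a power of the
discretely topologised four-element set ordered by its knowledge order: the topology is induced
from the product topology, and the order is the pointwise knowledge order. -/
def NaturalDual (A : Type u) [DistribBilattice A] : Type u := BilatticeHom A Four

namespace NaturalDual

variable {A : Type u} [DistribBilattice A]

instance : FunLike (NaturalDual A) A Four :=
  inferInstanceAs (FunLike (BilatticeHom A Four) A Four)

instance : TopologicalSpace (NaturalDual A) :=
  TopologicalSpace.induced (fun x : NaturalDual A => (x : A → Four)) inferInstance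

instance : PartialOrder (NaturalDual A) where
  le x y := ∀ a, LeK (x a) (y a)
  le_refl x a := LeK.refl (x a)
  le_trans _ _ _ hxy hyz a := (hxy a).trans (hyz a)
  le_antisymm _ _ hxy hyx := DFunLike.ext _ _ fun a => (hxy a).antisymm (hyx a)

theorem continuous_eval (a : A) : Continuous fun x : NaturalDual A => x a :=
  (continuous_apply a).comp continuous_induced_dom

instance : CompactSpace (NaturalDual A) := by
  have hind : Topology.IsInducing (fun x : NaturalDual A => (x : A → Four)) := ⟨rfl⟩
  have hrange : Set.range (fun x : NaturalDual A => (x : A → Four)) =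
      {f | (∀ a b, f (a ⊔ b) = f a ⊔ f b) ∧ (∀ a b, f (a ⊓ b) = f a ⊓ f b) ∧
        f ⊤ = ⊤ ∧ f ⊥ = ⊥ ∧ (∀ a, f (neg a) = neg (f a)) ∧ f botK = botK ∧ f topK = topK} := by
    ext f
    constructor
    · rintro ⟨x, rfl⟩
      exact ⟨fun a b => x.map_sup' a b, fun a b => x.map_inf' a b, x.map_top', x.map_bot',
        x.map_neg, x.map_botK, x.map_topK⟩
    · rintro ⟨h₁, h₂, h₃, h₄, h₅, h₆, h₇⟩
      exact ⟨(⟨⟨⟨⟨f, h₁⟩, h₂⟩, h₃, h₄⟩, h₅, h₆, h₇⟩ : BilatticeHom A Four), rfl⟩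
  have hclosed : IsClosed (Set.range (fun x : NaturalDual A => (x : A → Four))) := by
    rw [hrange]
    simp only [Set.ofPred_and, Set.ofPred_forall]
    refine .inter ?_ (.inter ?_ (.inter ?_ (.inter ?_ (.inter ?_ (.inter ?_ ?_)))))
    · exact isClosed_iInter fun a => isClosed_iInter fun b => isClosed_eq (continuous_apply _)
        ((continuous_of_discreteTopology (f := fun p : Four × Four => p.1 ⊔ p.2)).comp₂
          (continuous_apply a) (continuous_apply b))
    · exact isClosed_iInter fun a => isClosed_iInter fun b => isClosed_eq (continuous_apply _)
        ((continuous_of_discreteTopology (f := fun p : Four × Four => p.1 ⊓ p.2)).comp₂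
          (continuous_apply a) (continuous_apply b))
    · exact isClosed_eq (continuous_apply _) continuous_const
    · exact isClosed_eq (continuous_apply _) continuous_const
    · exact isClosed_iInter fun a => isClosed_eq (continuous_apply _)
        ((continuous_of_discreteTopology (f := fun p : Four => neg p)).comp (continuous_apply a))
    · exact isClosed_eq (continuous_apply _) continuous_const
    · exact isClosed_eq (continuous_apply _) continuous_const
  rw [← isCompact_univ_iff, hind.isCompact_iff, Set.image_univ]
  exact hclosed.isCompact

instance : PriestleySpace (NaturalDual A) where
  priestley {x y} h := by
    have h' : ¬ ∀ a, LeK (x a) (y a) := h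
    push Not at h'
    obtain ⟨a, ha⟩ := h'
    refine ⟨(fun z : NaturalDual A => z a) ⁻¹' {c | LeK (x a) c},
      (isClopen_discrete _).preimage (continuous_eval a), ?_, LeK.refl _, ha⟩
    intro z w hzw hz
    exact LeK.trans hz (hzw a)

end NaturalDual

/-- The natural dual of a distributive bilattice, as a Priestley space. -/
def naturalDual (A : Type u) [DistribBilattice A] : Priestley.{u} :=
  Priestley.of (NaturalDual A)

/-! The constants `topK` and `botK` are complements in the truth lattice, so a point `x` of its
Priestley dual sends exactly one of them to `true`. This splits the dual into two clopen pieces.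
Points of different pieces compare in opposite directions at `topK` and at `botK`, hence are
incomparable. The order-reversing involution `x ↦ x.conj`, built from negation, exchanges the pieces
because `neg` fixes `topK`.

A homomorphism to `Four` is a pair of points of the dual. Preserving `neg` forces the second to be
the conjugate of the first, and preserving `topK` puts the first in the piece `x topK = true`;
conversely each such `x` gives the homomorphism `(x, x.conj)`. The knowledge order is the truth
order on first coordinates, since the reversed condition on second coordinates then follows by
conjugation. So `fst` identifies the natural dual with one piece and `snd` identifies its order dual
with the other. -/

namespace DistribPreBilattice

variable {A : Type u} [DistribPreBilattice A]

/-- The unit law for `botK`, written out as a truth-lattice term and evaluated at `⊥` and `⊤`, gives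
the two halves. -/
theorem isCompl_topK_botK : IsCompl (topK : A) botK := by
  have key (a : A) : ((a ⊓ botK) ⊓ botK) ⊔ ((a ⊔ botK) ⊓ topK) = a := by
    rw [← supK_eq, supK_botK]
  refine .of_eq ?_ ?_
  · simpa [inf_comm] using key ⊥
  · simpa [sup_comm] using key ⊤

end DistribPreBilattice

open DistribPreBilattice (isCompl_topK_botK)

/-! ### Coordinates of the four-element bilattice -/

namespace Four

/-- The first coordinate, as a homomorphism on the truth lattice. -/
def fstHom : BoundedLatticeHom Four Bool where
  toFun a := a.1
  map_sup' _ _ := rfl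
  map_inf' _ _ := rfl
  map_top' := rfl
  map_bot' := rfl

/-- The second coordinate, as a homomorphism on the truth lattice. -/
def sndHom : BoundedLatticeHom Four Bool where
  toFun a := a.2
  map_sup' _ _ := rfl
  map_inf' _ _ := rfl
  map_top' := rfl
  map_bot' := rfl

theorem ext_fst_snd {a b : Four} (h₁ : fstHom a = fstHom b) (h₂ : sndHom a = sndHom b) : a = b :=
  Prod.ext h₁ h₂

/-- The reversal in the second coordinate is the source of the order dual in the second summand. -/
theorem leK_iff (a b : Four) : LeK a b ↔ fstHom a ≤ fstHom b ∧ sndHom b ≤ sndHom a := by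
  revert a b
  unfold LeK
  decide

theorem fstHom_neg (a : Four) : fstHom (neg a) = !sndHom a := rfl

theorem fstHom_topK : fstHom topK = true := rfl

theorem sndHom_topK : sndHom topK = false := rfl

end Four

/-! ### The involution on the Priestley dual -/

namespace PriestleyDual

variable {A : Type u} [DistribBilattice A]

theorem map_botK (x : PriestleyDual A) : x botK = !x topK := by
  have h₁ : x (topK ⊓ botK) = (x topK && x botK) := x.map_inf' _ _
  have h₂ : x (topK ⊔ botK) = (x topK || x botK) := x.map_sup' _ _
  rw [isCompl_topK_botK.inf_eq_bot, show x ⊥ = false from x.map_bot'] at h₁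
  rw [isCompl_topK_botK.sup_eq_top, show x ⊤ = true from x.map_top'] at h₂
  revert h₁ h₂
  cases x topK <;> cases x botK <;> simp

/-- The homomorphism `a ↦ !x (neg a)`. -/
def conj (x : PriestleyDual A) : PriestleyDual A where
  toFun a := !x (neg a)
  map_sup' a b := by
    rw [DistribBilattice.neg_sup, show x (neg a ⊓ neg b) = (x (neg a) && x (neg b)) from
      x.map_inf' _ _, Bool.not_and]
    rfl
  map_inf' a b := by
    rw [DistribBilattice.neg_inf, show x (neg a ⊔ neg b) = (x (neg a) || x (neg b)) from
      x.map_sup' _ _, Bool.not_or]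
    rfl
  map_top' := by
    rw [DistribBilattice.neg_top, show x ⊥ = false from x.map_bot']
    rfl
  map_bot' := by
    rw [DistribBilattice.neg_bot, show x ⊤ = true from x.map_top']
    rfl

theorem conj_apply (x : PriestleyDual A) (a : A) : x.conj a = !x (neg a) := rfl

theorem conj_conj (x : PriestleyDual A) : x.conj.conj = x :=
  DFunLike.ext _ _ fun a => by
    rw [conj_apply, conj_apply, DistribBilattice.neg_neg, Bool.not_not]

/-- Conjugation exchanges the two pieces of the dual. -/
theorem conj_topK (x : PriestleyDual A) : x.conj topK = !x topK := by
  rw [conj_apply, DistribBilattice.neg_topK]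

theorem conj_le_conj {x y : PriestleyDual A} (h : x ≤ y) : y.conj ≤ x.conj := fun a => by
  have h₁ : x (neg a) ≤ y (neg a) := h (neg a)
  change (!y (neg a)) ≤ !x (neg a)
  revert h₁
  cases x (neg a) <;> cases y (neg a) <;> decide

theorem conj_le_conj_iff {x y : PriestleyDual A} : y.conj ≤ x.conj ↔ x ≤ y :=
  ⟨fun h => by simpa only [conj_conj] using conj_le_conj h, conj_le_conj⟩

end PriestleyDual

/-! ### Homomorphisms to `Four` as conjugate pairs -/

namespace NaturalDual

variable {A : Type u} [DistribBilattice A]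

/-- The first coordinate of a homomorphism to `Four`. -/
noncomputable def fst (f : NaturalDual A) : PriestleyDual A := Four.fstHom.comp f.toBoundedLatticeHom

/-- The second coordinate of a homomorphism to `Four`. -/
noncomputable def snd (f : NaturalDual A) : PriestleyDual A := Four.sndHom.comp f.toBoundedLatticeHom

theorem fst_apply (f : NaturalDual A) (a : A) : f.fst a = Four.fstHom (f a) := rfl

theorem snd_apply (f : NaturalDual A) (a : A) : f.snd a = Four.sndHom (f a) := rfl

/-- Comparing first coordinates in `f (neg a) = neg (f a)` shows that `f` is determined by `f.fst`.
-/
theorem conj_fst (f : NaturalDual A) : f.fst.conj = f.snd :=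
  DFunLike.ext _ _ fun a => by
    rw [PriestleyDual.conj_apply, fst_apply, snd_apply, show f (neg a) = neg (f a) from
      f.map_neg a, Four.fstHom_neg, Bool.not_not]

theorem fst_topK (f : NaturalDual A) : f.fst topK = true := by
  rw [fst_apply, show f topK = topK from f.map_topK, Four.fstHom_topK]

theorem snd_topK (f : NaturalDual A) : f.snd topK = false := by
  rw [snd_apply, show f topK = topK from f.map_topK, Four.sndHom_topK]

theorem snd_le_snd_iff {f g : NaturalDual A} : g.snd ≤ f.snd ↔ f.fst ≤ g.fst := by
  rw [← conj_fst, ← conj_fst, PriestleyDual.conj_le_conj_iff]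

theorem fst_le_fst_iff {f g : NaturalDual A} : f.fst ≤ g.fst ↔ f ≤ g := by
  have h : f ≤ g ↔ f.fst ≤ g.fst ∧ g.snd ≤ f.snd :=
    (forall_congr' fun a => Four.leK_iff (f a) (g a)).trans forall_and
  rw [h, snd_le_snd_iff, and_self]

theorem continuous_fst : Continuous (fst : NaturalDual A → PriestleyDual A) :=
  continuous_induced_rng.2 <| continuous_pi fun a =>
    (continuous_of_discreteTopology (f := Four.fstHom)).comp (continuous_eval a)

theorem continuous_snd : Continuous (snd : NaturalDual A → PriestleyDual A) :=
  continuous_induced_rng.2 <| continuous_pi fun a =>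
    (continuous_of_discreteTopology (f := Four.sndHom)).comp (continuous_eval a)

/-- The homomorphism to `Four` with first coordinate `x`. -/
def ofFst (x : PriestleyDual A) (hx : x topK = true) : NaturalDual A where
  toFun a := (x a, x.conj a)
  map_sup' a b := Prod.ext (x.map_sup' a b) (x.conj.map_sup' a b)
  map_inf' a b := Prod.ext (x.map_inf' a b) (x.conj.map_inf' a b)
  map_top' := Prod.ext x.map_top' x.conj.map_top'
  map_bot' := Prod.ext x.map_bot' x.conj.map_bot'
  map_neg a := by
    refine Four.ext_fst_snd ?_ ?_
    · exact (Bool.not_not _).symm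
    · exact congrArg (fun b => !x b) (DistribBilattice.neg_neg a)
  map_botK := by
    refine Four.ext_fst_snd ?_ ?_
    · change x botK = false
      rw [x.map_botK, hx, Bool.not_true]
    · change x.conj botK = true
      rw [x.conj.map_botK, x.conj_topK, hx, Bool.not_not]
  map_topK := by
    refine Four.ext_fst_snd hx ?_
    change x.conj topK = false
    rw [x.conj_topK, hx, Bool.not_true]

theorem fst_ofFst (x : PriestleyDual A) (hx : x topK = true) : (ofFst x hx).fst = x := rfl

/-- The map given by the first coordinate on the first summand and by the second coordinate on the
second summand. -/
noncomputable def toPriestleyDual : NaturalDual A ⊕ (NaturalDual A)ᵒᵈ → PriestleyDual A :=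
  Sum.elim fst fun f => snd (OrderDual.ofDual f)

theorem toPriestleyDual_le_iff {p q : NaturalDual A ⊕ (NaturalDual A)ᵒᵈ} :
    toPriestleyDual p ≤ toPriestleyDual q ↔ p ≤ q := by
  rcases p with f | f <;> rcases q with g | g
  · exact fst_le_fst_iff.trans Sum.inl_le_inl_iff.symm
  · refine iff_of_false (fun h => ?_) Sum.not_inl_le_inr
    have h₁ : f.fst topK ≤ (snd (OrderDual.ofDual g)) topK := h topK
    rw [fst_topK, snd_topK] at h₁
    exact absurd h₁ (by decide)
  · refine iff_of_false (fun h => ?_) Sum.not_inr_le_inl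
    -- At `topK` the inequality reads `false ≤ true` and gives nothing; the complement `botK`
    -- reverses it.
    have h₁ : (snd (OrderDual.ofDual f)) botK ≤ g.fst botK := h botK
    rw [PriestleyDual.map_botK, PriestleyDual.map_botK, fst_topK, snd_topK] at h₁
    exact absurd h₁ (by decide)
  · exact (snd_le_snd_iff.trans fst_le_fst_iff).trans
      (OrderDual.ofDual_le_ofDual.trans Sum.inr_le_inr_iff.symm)

theorem toPriestleyDual_surjective :
    Function.Surjective (toPriestleyDual : NaturalDual A ⊕ (NaturalDual A)ᵒᵈ → _) := fun x => by
  cases hx : x topK with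
  | true => exact ⟨Sum.inl (ofFst x hx), fst_ofFst x hx⟩
  | false =>
    -- The conjugate lies in the first piece, and the homomorphism it defines has second coordinate
    -- `x.conj.conj = x`.
    have hx' : x.conj topK = true := by rw [x.conj_topK, hx, Bool.not_false]
    refine ⟨Sum.inr (OrderDual.toDual (ofFst x.conj hx')), ?_⟩
    change (ofFst x.conj hx').snd = x
    rw [← conj_fst, fst_ofFst, x.conj_conj]

theorem continuous_toPriestleyDual :
    Continuous (toPriestleyDual : NaturalDual A ⊕ (NaturalDual A)ᵒᵈ → _) :=
  continuous_fst.sumElim continuous_snd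

end NaturalDual

/-! ### Isomorphisms of Priestley spaces -/

namespace Priestley

/-- A continuous surjective order embedding of Priestley spaces is an isomorphism. -/
noncomputable def isoOfSurjective {X Y : Priestley.{u}} (f : X.carrier → Y.carrier)
    (hcont : Continuous f) (hle : ∀ {a b}, f a ≤ f b ↔ a ≤ b) (hsurj : Function.Surjective f) :
    X ≅ Y :=
  let e : X.carrier ≃o Y.carrier :=
    RelIso.ofSurjective (OrderEmbedding.ofMapLEIff f fun _ _ => hle) hsurj
  { hom := ⟨⟨⟨e, e.monotone⟩, hcont⟩⟩
    inv := ⟨⟨⟨e.symm, e.symm.monotone⟩,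
      -- Priestley spaces are compact and Hausdorff, so a continuous bijection between them is a
      -- homeomorphism.
      Continuous.continuous_symm_of_equiv_compact_to_t2 (f := e.toEquiv) hcont⟩⟩
    hom_inv_id := Hom.ext (ContinuousOrderHom.ext fun a => e.symm_apply_apply a)
    inv_hom_id := Hom.ext (ContinuousOrderHom.ext fun a => e.apply_symm_apply a) }

/-- The coproduct is the disjoint union. -/
noncomputable def coprodIsoDisjointUnion (X Y : Priestley.{u}) : X ⨿ Y ≅ disjointUnion X Y :=
  (coprodIsCoprod X Y).coconePointUniqueUpToIso (disjointUnionIsColimit X Y)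

end Priestley

/-- The dual of the truth lattice is the disjoint union of the natural dual and its order dual. -/
noncomputable def disjointUnionNaturalDualIso (A : Type u) [DistribBilattice A] :
    (naturalDual A).disjointUnion (naturalDual A).orderDual ≅ priestleyDual A :=
  Priestley.isoOfSurjective (X := (naturalDual A).disjointUnion (naturalDual A).orderDual)
    (Y := priestleyDual A) NaturalDual.toPriestleyDual NaturalDual.continuous_toPriestleyDual
    NaturalDual.toPriestleyDual_le_iff NaturalDual.toPriestleyDual_surjective

theorem theorem7p1 (A : Type u) [DistribBilattice A] :
    Nonempty (priestleyDual A ≅ naturalDual A ⨿ (naturalDual A).orderDual) ∧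
    Nonempty (priestleyDual A ≅ (naturalDual A).disjointUnion (naturalDual A).orderDual) :=
  ⟨⟨(disjointUnionNaturalDualIso A).symm ≪≫ (Priestley.coprodIsoDisjointUnion _ _).symm⟩,
    ⟨(disjointUnionNaturalDualIso A).symm⟩⟩
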